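/- **Conventions.** Identify finite subsets of $\mathbb N$ with their characteristic functions in $\{0,1\}^{\mathbb N}$, with the product topology. For a finite $s$ let $s(1)<s(2)<\dots<s(|s|)$ be its elements, and similarly $L(1)<L(2)<\cdots$ for an infinite $L\subseteq\mathbb N$. Write $t\sqsubseteq s$ if $t$ is an initial segment of $s$. For a family $\mathcal F$ of finite subsets of $\mathbb N$ put $\widehat{\mathcal F}=\{t:\ t\sqsubseteq s\text{ for some }s\in\mathcal F\}$ and $\mathcal F\upharpoonright L=\{s\in\mathcal F: s\subseteq L\}$. The family $\mathcal F$ is *regular thin* if no member is a proper initial segment of another member and $\widehat{\mathcal F}$ is closed in $\{0,1\}^{\mathbb N}$, hereditary (closed under subsets), and spreading (if $\{n_1<\dots<n_k\}\in\widehat{\mathcal F}$, $m_1<\dots<m_k$ and $n_i\le m_i$ for all $i$, then $\{m_1,\dots,m_k\}\in\widehat{\mathcal F}$). A tuple $(s_1,\dots,s_k)$ of nonempty finite sets is *plegma* if $s_i(p)<s_j(p)$ whenever $i<j$ and $p\le\min(|s_i|,|s_j|)$, and $s_i(p)<s_j(p+1)$ for all $i,j$ and all $p\le\min(|s_i|,|s_j|-1)$.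 Let $(E,\|\cdot\|_*)$ be a real seminormed space with Hamel basis $(e_n)_{n\in\mathbb N}$. A family $(x_s)_{s\in\mathcal F\upharpoonright L}$ in a real Banach space $X$ *generates $(e_n)$ as a spreading model* if there are $\delta_l>0$ with $\delta_l\to0$ such that $$\Big|\,\Big\|\sum_{j=1}^k a_jx_{s_j}\Big\|-\Big\|\sum_{j=1}^k a_je_j\Big\|_*\Big|\le\delta_l$$ for all $1\le k\le l$, all plegma $k$-tuples $(s_j)_{j=1}^k$ in $\mathcal F\upharpoonright L$ with $s_1(1)\ge L(l)$, and all $a_1,\dots,a_k\in[-1,1]$. **Theorem.** Let $\mathcal F$ be a regular thin family containing a nonempty set, let $L\subseteq\mathbb N$ be infinite, and let $(x_s)_{s\in\mathcal F\upharpoonright L}$ be a family in a real Banach space $X$ generating $(e_n)_{n}$ as a spreading model. Suppose that $(x_s)_{s\in\mathcal F\upharpoonright L}$ is subordinated with respect to the weak topology, i.e. there is a continuous map $\widehat\varphi:\widehat{\mathcal F\upharpoonright L}\to(X,w)$ with $\widehat\varphi(s)=x_s$ for all $s\in\mathcal F\upharpoonright L$, and suppose that $\widehat\varphi(\emptyset)=0$.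 Then either $(e_n)_n$ is trivial, i.e. $\big\|\sum_{i=1}^na_ie_i\big\|_*=\big|\sum_{i=1}^na_i\big|\,\|e_1\|_*$ for all $n$ and all real $a_1,\dots,a_n$, with $\|e_n\|_*=0$ for all $n$; or $(e_n)_n$ is $1$-unconditional, i.e. for all $n$, all $A\subseteq\{1,\dots,n\}$ and all real $a_1,\dots,a_n$, $$\Big\|\sum_{i\in A}a_ie_i\Big\|_*\le\Big\|\sum_{i=1}^na_ie_i\Big\|_*.$$ -/

import Mathlib

open Filter Topology

namespace FSpreading

/-- The characteristic function of a finite set of natural numbers, as a point of `{0,1}^ℕ`. -/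
def charFun (s : Finset ℕ) : ℕ → Bool := fun n => decide (n ∈ s)

/-- Finite sets of natural numbers carry the topology of pointwise convergence of their
characteristic functions, i.e. the topology induced from the product space `{0,1}^ℕ`. -/
instance finsetTopology : TopologicalSpace (Finset ℕ) :=
  TopologicalSpace.induced charFun inferInstance

/-- `t ⊑ s`: the finite set `t` is an initial segment of the finite set `s`. -/
def IsInitSeg (t s : Finset ℕ) : Prop :=
  t ⊆ s ∧ ∀ a ∈ s, ∀ b ∈ t, a ≤ b → a ∈ t

/-- The closure `F̂` of a family `F`: all initial segments of members of `F`. -/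
def initClosure (F : Set (Finset ℕ)) : Set (Finset ℕ) :=
  {t | ∃ s ∈ F, IsInitSeg t s}

/-- The restriction `F ↾ L`: the members of `F` that are subsets of `L`. -/
def restrict (F : Set (Finset ℕ)) (L : Set ℕ) : Set (Finset ℕ) :=
  {s | s ∈ F ∧ (s : Set ℕ) ⊆ L}

/-- A family is hereditary if it contains all subsets of its members. -/
def IsHereditary (F : Set (Finset ℕ)) : Prop :=
  ∀ s ∈ F, ∀ t, t ⊆ s → t ∈ F

/-- A family is spreading if `{n₁ < ⋯ < nₖ} ∈ F` and `nᵢ ≤ mᵢ`, `m₁ < ⋯ < mₖ`, imply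
`{m₁, …, mₖ} ∈ F`. -/
def IsSpreading (F : Set (Finset ℕ)) : Prop :=
  ∀ (k : ℕ) (n m : Fin k → ℕ), StrictMono n → StrictMono m → (∀ i, n i ≤ m i) →
    Finset.univ.image n ∈ F → Finset.univ.image m ∈ F

/-- A family is compact if the characteristic functions of its members form a closed subset
of `{0,1}^ℕ`. -/
def IsCompactFamily (F : Set (Finset ℕ)) : Prop :=
  IsClosed (charFun '' F)

/-- Regular families: compact, hereditary and spreading. -/
structure IsRegular (F : Set (Finset ℕ)) : Prop where
  compact : IsCompactFamily F
  hereditary : IsHereditary F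
  spreading : IsSpreading F

/-- A family is thin if no member is a proper initial segment of another one. -/
def IsThin (F : Set (Finset ℕ)) : Prop :=
  ∀ s ∈ F, ∀ t ∈ F, IsInitSeg s t → s = t

/-- Regular thin families: thin families whose closure is regular. -/
structure IsRegularThin (F : Set (Finset ℕ)) : Prop where
  thin : IsThin F
  regular : IsRegular (initClosure F)

/-- The element of `A ⊆ ℕ` at position `i` in increasing order, counted from `0`. It is used
only for infinite `A`, and for finite `A` only when `i < |A|`. -/
noncomputable def elt (A : Set ℕ) (i : ℕ) : ℕ := Nat.nth (fun n => n ∈ A) i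

/-- A tuple `(s₁, …, sₗ)` of nonempty finite sets is plegma if
(i) `sᵢ(p) < sⱼ(p)` whenever `i < j` and both elements exist, and
(ii) `sᵢ(p) < sⱼ(p + 1)` for all `i, j` whenever both elements exist. -/
structure IsPlegma {l : ℕ} (s : Fin l → Finset ℕ) : Prop where
  nonempty : ∀ i, (s i).Nonempty
  lt_of_lt : ∀ i j, i < j → ∀ p, p < (s i).card → p < (s j).card →
    elt (s i) p < elt (s j) p
  lt_succ : ∀ i j, ∀ p, p < (s i).card → p + 1 < (s j).card →
    elt (s i) p < elt (s j) (p + 1)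

/-- `(x_s)`, `s ∈ F ↾ M`, generates the Hamel basis `e` of the seminormed space `E` as an
`F`-spreading model: there are positive `δ l → 0` such that
`|‖∑ aⱼ x_{sⱼ}‖ - ‖∑ aⱼ eⱼ‖| ≤ δ l` for all `1 ≤ k ≤ l`, all plegma `k`-tuples
`(s₁, …, sₖ)` in `F ↾ M` whose first set has its first element at least the `l`-th element
of `M`, and all `aⱼ ∈ [-1,1]`.
Only the values of `x` on `F ↾ M` enter. The sequence `e` is indexed from `0`, and the `l`-th
element of `M` is `elt M (l - 1)` because `elt` counts from `0` (here `1 ≤ l`). -/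
def Generates {X E : Type*} [NormedAddCommGroup X] [NormedSpace ℝ X]
    [SeminormedAddCommGroup E] [NormedSpace ℝ E]
    (F : Set (Finset ℕ)) (M : Set ℕ) (x : Finset ℕ → X) (e : Module.Basis ℕ ℝ E) : Prop :=
  ∃ δ : ℕ → ℝ, (∀ l, 0 < δ l) ∧ Tendsto δ atTop (𝓝 0) ∧
    ∀ (k l : ℕ) (hk : 1 ≤ k), k ≤ l →
      ∀ s : Fin k → Finset ℕ, (∀ j, s j ∈ restrict F M) → IsPlegma s →
        elt M (l - 1) ≤ elt (s ⟨0, hk⟩) 0 →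
        ∀ a : Fin k → ℝ, (∀ j, a j ∈ Set.Icc (-1 : ℝ) 1) →
          |‖∑ j, a j • x (s j)‖ - ‖∑ j, a j • e (j : ℕ)‖| ≤ δ l

/-- `(x_s)`, `s ∈ F ↾ M`, is subordinated with respect to the weak topology of `X`, witnessed by
`φ`: the map `φ` is continuous from the closure of `F ↾ M` to `X` with its weak topology and
`φ s = x_s` on `F ↾ M`. Only the values of `φ` on the closure of `F ↾ M` enter. -/
structure IsWeaklySubordinatedBy {X : Type*} [NormedAddCommGroup X] [NormedSpace ℝ X]
    (F : Set (Finset ℕ)) (M : Set ℕ) (x : Finset ℕ → X)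
    (φ : Finset ℕ → WeakSpace ℝ X) : Prop where
  continuousOn : ContinuousOn φ (initClosure (restrict F M))
  extends_eq : ∀ s ∈ restrict F M, φ s = toWeakSpace ℝ X (x s)

/-- A sequence is trivial if `‖∑ aᵢ eᵢ‖ = |∑ aᵢ| ‖e₁‖` for all finitely many scalars. -/
def IsTrivialSeq {E : Type*} [SeminormedAddCommGroup E] [NormedSpace ℝ E] (e : ℕ → E) : Prop :=
  ∀ (n : ℕ) (a : Fin n → ℝ), ‖∑ i, a i • e (i : ℕ)‖ = |∑ i, a i| * ‖e 0‖

/-- A sequence is 1-unconditional if `‖∑_{i ∈ A} aᵢ eᵢ‖ ≤ ‖∑_{i ≤ n} aᵢ eᵢ‖` for all `n`, all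
scalars and all sets `A` of indices up to `n`. -/
def IsOneUnconditional {E : Type*} [SeminormedAddCommGroup E] [NormedSpace ℝ E]
    (e : ℕ → E) : Prop :=
  ∀ (n : ℕ) (A : Finset (Fin n)) (a : Fin n → ℝ),
    ‖∑ i ∈ A, a i • e (i : ℕ)‖ ≤ ‖∑ i, a i • e (i : ℕ)‖

end FSpreading

namespace FSpreading

/-! The second alternative always holds. It suffices to find, arbitrarily far out, plegma tuples for
which deleting the terms outside `A` barely increases the norm; the spreading model inherits the
inequality in the limit. Weak continuity with `φ ∅ = 0` lets one climb from `∅` to a member `s` of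
`F ↾ L`, one element at a time, losing little on a given functional, so that `f (x s) ≥ -ε`. Weak*
compactness of the dual ball confines each choice to a finite block fixed before the functional is
known (`exists_next_block`, `exists_blocks`). Interleaving the blocks makes every resulting tuple
plegma. One then picks `s j` for `j ∈ A`, takes `f` norming their combination, and picks the other
`s j` for the functionals `a j • f`: the deleted terms contribute at least `-n * ε` to `f`
(`exists_plegma_norm_sum_le`). -/

lemma IsInitSeg.refl (s : Finset ℕ) : IsInitSeg s s :=
  ⟨subset_rfl, fun _ ha _ _ _ => ha⟩

lemma isInitSeg_insert {t : Finset ℕ} {m : ℕ} (hm : ∀ a ∈ t, a < m) :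
    IsInitSeg t (insert m t) := by
  refine ⟨Finset.subset_insert _ _, fun a ha b hb hab => ?_⟩
  rcases Finset.mem_insert.1 ha with rfl | h
  · exact absurd (hm b hb) (by omega)
  · exact h

lemma IsInitSeg.trans {r s t : Finset ℕ} (h : IsInitSeg r s) (h' : IsInitSeg s t) :
    IsInitSeg r t :=
  ⟨h.1.trans h'.1, fun a ha b hb hab => h.2 a (h'.2 a ha b (h.1 hb) hab) b hb hab⟩

lemma mem_initClosure {F : Set (Finset ℕ)} {s : Finset ℕ} (hs : s ∈ F) : s ∈ initClosure F :=
  ⟨s, hs, IsInitSeg.refl s⟩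

/-! ### Extending initial segments inside a regular thin family. -/

/-- One-point end extension inside a family. -/
def EndExtends (G : Set (Finset ℕ)) (t' t : Finset ℕ) : Prop :=
  t' ∈ G ∧ ∃ m, (∀ a ∈ t, a < m) ∧ t' = insert m t

/-- An infinite chain of end extensions converges pointwise to the indicator of an infinite set,
which closedness excludes. This is what makes climbing to a member of `F` terminate. -/
lemma IsCompactFamily.wellFounded_endExtends {G : Set (Finset ℕ)} (hG : IsCompactFamily G) :
    WellFounded (EndExtends G) := by
  rw [wellFounded_iff_isEmpty_descending_chain]
  refine ⟨fun ⟨u, hu⟩ => ?_⟩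
  have hmono : Monotone u := monotone_nat_of_le_succ fun n => by
    obtain ⟨-, m, -, h⟩ := hu n
    rw [h]
    exact Finset.subset_insert _ _
  have hcard : ∀ n, n ≤ (u n).card := by
    intro n
    induction n with
    | zero => exact Nat.zero_le _
    | succ n ih =>
      obtain ⟨-, m, hm, h⟩ := hu n
      rw [h, Finset.card_insert_of_notMem fun hmu => (hm m hmu).false]
      omega
  classical
  have hlim : Tendsto (fun n => charFun (u (n + 1))) atTop
      (𝓝 fun i => decide (∃ n, i ∈ u n)) := by
    rw [tendsto_pi_nhds]
    intro i
    refine tendsto_const_nhds.congr' ?_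
    by_cases h : ∃ n, i ∈ u n
    · obtain ⟨n, hn⟩ := h
      filter_upwards [eventually_ge_atTop n] with k hk
      have h1 : i ∈ u (k + 1) := hmono (by omega : n ≤ k + 1) hn
      have h2 : ∃ n, i ∈ u n := ⟨n, hn⟩
      simp [charFun, h1, h2]
    · refine Eventually.of_forall fun k => ?_
      have h1 : i ∉ u (k + 1) := fun h' => h ⟨_, h'⟩
      simp only [charFun, h1, h]
  obtain ⟨v, -, hv⟩ := hG.mem_of_tendsto hlim
    (Eventually.of_forall fun n => ⟨_, (hu n).1, rfl⟩)
  have hsub : u (v.card + 1) ⊆ v := fun i hi => by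
    have := congrFun hv i
    simp only [charFun, decide_eq_decide] at this
    exact this.2 ⟨_, hi⟩
  have h1 := Finset.card_le_card hsub
  have h2 := hcard (v.card + 1)
  omega

lemma IsRegularThin.empty_notMem {F : Set (Finset ℕ)} (hF : IsRegularThin F)
    (hF1 : ∃ s ∈ F, s.Nonempty) : ∅ ∉ F := by
  intro h
  obtain ⟨s, hs, hne⟩ := hF1
  have := hF.thin ∅ h s hs ⟨Finset.empty_subset _, by simp⟩
  exact hne.ne_empty this.symm

/-- Take `q` in a member of `F` properly extending `t`; heredity puts `insert q t` in the closure,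
and spreading moves `q` up to any larger `m`. -/
lemma IsRegularThin.exists_insert_mem {F : Set (Finset ℕ)} (hF : IsRegularThin F)
    {t : Finset ℕ} (ht : t ∈ initClosure F) (htF : t ∉ F) :
    ∃ q, ∀ m, q ≤ m → (∀ a ∈ t, a < m) ∧ insert m t ∈ initClosure F := by
  obtain ⟨s, hs, hts⟩ := ht
  have hne : ¬ s ⊆ t := fun h => htF (by rwa [hts.1.antisymm h])
  obtain ⟨q, hqs, hqt⟩ := Finset.not_subset.1 hne
  have hlt : ∀ a ∈ t, a < q := fun a ha => by
    by_contra h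
    exact hqt (hts.2 q hqs a ha (not_lt.1 h))
  refine ⟨q, fun m hm => ⟨fun a ha => (hlt a ha).trans_le hm, ?_⟩⟩
  have hq : insert q t ∈ initClosure F :=
    hF.regular.hereditary s (mem_initClosure hs) _ (Finset.insert_subset hqs hts.1)
  set n := (insert q t).orderEmbOfFin rfl with hn
  have hmem : ∀ i, n i = q ∨ n i ∈ t := fun i =>
    Finset.mem_insert.1 (Finset.orderEmbOfFin_mem (insert q t) rfl i)
  have himg : Finset.univ.image n = insert q t := by
    apply Finset.coe_injective
    rw [Finset.coe_image, Finset.coe_univ, Set.image_univ, hn, Finset.range_orderEmbOfFin]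
  let g : ℕ → ℕ := fun a => if a = q then m else a
  have hg : ∀ a ∈ t, g a = a := fun a ha => if_neg (hlt a ha).ne
  have hgq : g q = m := if_pos rfl
  have key := hF.regular.spreading _ n (fun i => g (n i)) n.strictMono ?_ ?_ (by rw [himg]; exact hq)
  · have : Finset.univ.image (fun i => g (n i)) = insert m t := by
      rw [← Function.comp_def g n, ← Finset.image_image, himg, Finset.image_insert, hgq,
        Finset.image_congr (g := id) (fun a ha => hg a ha), Finset.image_id]
    rwa [this] at key
  · intro i j hij
    have hij' : n i < n j := n.strictMono hij
    show g (n i) < g (n j)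
    rcases hmem i with hi | hi
    · rcases hmem j with hj | hj
      · omega
      · have := hlt _ hj
        omega
    · rw [hg _ hi]
      rcases hmem j with hj | hj
      · rw [hj, hgq]
        exact (hlt _ hi).trans_le hm
      · rwa [hg _ hj]
  · intro i
    rcases hmem i with hi | hi
    · rw [hi, hgq]
      exact hm
    · rw [hg _ hi]

/-- Keep adding large elements of `L` until a member of `F` is reached. Needed because `φ` is
continuous only on the closure of `F ↾ L`. -/
lemma IsRegularThin.mem_initClosure_restrict {F : Set (Finset ℕ)} (hF : IsRegularThin F)
    {L : Set ℕ} (hL : L.Infinite) {t : Finset ℕ} (ht : t ∈ initClosure F)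
    (htL : (t : Set ℕ) ⊆ L) : t ∈ initClosure (restrict F L) := by
  induction t using hF.regular.compact.wellFounded_endExtends.induction with
  | _ t ih =>
    by_cases htF : t ∈ F
    · exact mem_initClosure ⟨htF, htL⟩
    obtain ⟨q, hq⟩ := hF.exists_insert_mem ht htF
    obtain ⟨m, hmL, hqm⟩ := hL.exists_gt q
    obtain ⟨hm, hmt⟩ := hq m hqm.le
    obtain ⟨s, hs, hts⟩ := ih _ ⟨hmt, m, hm, rfl⟩ hmt
      (by rw [Finset.coe_insert]; exact Set.insert_subset hmL htL)
    exact ⟨s, hs, (isInitSeg_insert hm).trans hts⟩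

lemma tendsto_insert (t : Finset ℕ) : Tendsto (fun m => insert m t) atTop (𝓝 t) := by
  rw [nhds_induced, tendsto_comap_iff, tendsto_pi_nhds]
  intro i
  refine tendsto_const_nhds.congr' ?_
  filter_upwards [eventually_gt_atTop i] with m hm
  simp [charFun, hm.ne]

/-! ### Positions of elements in finite sets. -/

lemma elt_mem {s : Finset ℕ} {p : ℕ} (hp : p < s.card) : elt (s : Set ℕ) p ∈ s :=
  Nat.nth_mem (p := fun n => n ∈ (s : Set ℕ)) p fun hf => by
    convert hp
    ext a
    simp

lemma elt_count {s : Finset ℕ} {a : ℕ} (ha : a ∈ s) : elt (s : Set ℕ) {b ∈ s | b < a}.card = a := by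
  classical
  have h := Nat.nth_count (p := fun n => n ∈ (s : Set ℕ)) (n := a) (by simpa using ha)
  rw [Nat.count_eq_card_filter_range] at h
  rw [elt]
  convert h using 3
  ext b
  simp [and_comm]

lemma exists_elt_eq {s : Finset ℕ} {p : ℕ} (hp : p < s.card) :
    ∃ a ∈ s, {b ∈ s | b < a}.card = p ∧ elt (s : Set ℕ) p = a := by
  refine ⟨_, elt_mem hp, ?_, rfl⟩
  classical
  have h := Nat.count_nth (p := fun n => n ∈ (s : Set ℕ)) (n := p) fun hf => by
    convert hp
    ext a
    simp
  rw [Nat.count_eq_card_filter_range] at h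
  convert h using 2
  ext b
  simp [and_comm, elt]

lemma elt_insert_card {t : Finset ℕ} {m : ℕ} (hm : ∀ a ∈ t, a < m) :
    elt ((insert m t : Finset ℕ) : Set ℕ) t.card = m := by
  convert elt_count (Finset.mem_insert_self m t) using 3
  ext b
  simp only [Finset.mem_filter, Finset.mem_insert]
  refine ⟨fun h => ⟨Or.inr h, hm b h⟩, ?_⟩
  rintro ⟨rfl | h, h'⟩
  · omega
  · exact h

lemma elt_insert_of_lt_card {t : Finset ℕ} {m p : ℕ} (hm : ∀ a ∈ t, a < m) (hp : p < t.card) :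
    elt ((insert m t : Finset ℕ) : Set ℕ) p = elt (t : Set ℕ) p := by
  obtain ⟨a, ha, hcard, he⟩ := exists_elt_eq hp
  rw [he]
  convert elt_count (Finset.mem_insert_of_mem (b := m) ha) using 2
  rw [← hcard]
  congr 1
  ext b
  simp only [Finset.mem_filter, Finset.mem_insert]
  have := hm a ha
  refine ⟨fun h => ⟨Or.inr h.1, h.2⟩, ?_⟩
  rintro ⟨rfl | h, h'⟩
  · omega
  · exact ⟨h, h'⟩

/-! ### Finite blocks that serve all functionals of the dual ball. -/

section Weak

variable {X : Type*} [NormedAddCommGroup X] [NormedSpace ℝ X]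

lemma continuous_apply_toWeakSpace_symm (f : StrongDual ℝ X) :
    Continuous fun w : WeakSpace ℝ X => f ((toWeakSpace ℝ X).symm w) :=
  WeakBilin.eval_continuous (topDualPairing ℝ X).flip f

/-- By weak convergence along `S`, the weak* open sets `{f | f z - ε < f (y m)}` with `m ∈ S` cover
the dual ball, and Banach–Alaoglu gives a finite subcover. -/
lemma exists_finset_forall_dual_lt {y : ℕ → X} {z : X} {S : Set ℕ} (hS : S.Infinite)
    (h : ∀ f : StrongDual ℝ X, Tendsto (fun m => f (y m)) (atTop ⊓ 𝓟 S) (𝓝 (f z)))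
    {ε : ℝ} (hε : 0 < ε) :
    ∃ C : Finset ℕ, (C : Set ℕ) ⊆ S ∧
      ∀ f : StrongDual ℝ X, ‖f‖ ≤ 1 → ∃ c ∈ C, f z - ε < f (y c) := by
  classical
  obtain ⟨C, hC⟩ := (WeakDual.isCompact_closedBall (𝕜 := ℝ) (E := X) 0 1).elim_finite_subcover
    (fun m : S => {f : WeakDual ℝ X | f z - ε < f (y m)})
    (fun m => isOpen_lt ((WeakDual.eval_continuous z).sub continuous_const)
      (WeakDual.eval_continuous (y m))) (by
      intro f _
      have hev := (h (WeakDual.toStrongDual f)).eventually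
        (lt_mem_nhds (sub_lt_self (WeakDual.toStrongDual f z) hε))
      rw [eventually_inf_principal, eventually_atTop] at hev
      obtain ⟨N, hN⟩ := hev
      obtain ⟨m, hmS, hm⟩ := hS.exists_gt N
      exact Set.mem_iUnion.2 ⟨⟨m, hmS⟩, hN m hm.le hmS⟩)
  refine ⟨C.image Subtype.val, by simp, fun f hf => ?_⟩
  have hmem : StrongDual.toWeakDual f ∈ WeakDual.toStrongDual ⁻¹' Metric.closedBall 0 1 := by
    simpa using hf
  obtain ⟨c, hc, hfc⟩ := Set.mem_iUnion₂.1 (hC hmem)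
  exact ⟨c, Finset.mem_image_of_mem _ hc, hfc⟩

variable {F : Set (Finset ℕ)} {L : Set ℕ} {x : Finset ℕ → X} {φ : Finset ℕ → WeakSpace ℝ X}

/-- Given a finite set `U`, there is a finite set `D ⊆ L` beyond `U` along which every
non-maximal `t ⊆ U` can be extended, with little loss for each functional of the dual ball. -/
lemma exists_next_block (hF : IsRegularThin F) (hL : L.Infinite)
    (hφ : IsWeaklySubordinatedBy F L x φ) (U : Finset ℕ) {ε : ℝ} (hε : 0 < ε) :
    ∃ D : Finset ℕ, (D : Set ℕ) ⊆ L ∧ (∀ m ∈ D, ∀ a ∈ U, a < m) ∧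
      ∀ t ⊆ U, t ∈ initClosure F → t ∉ F → (t : Set ℕ) ⊆ L →
        (∀ m ∈ D, insert m t ∈ initClosure F) ∧
        ∀ f : StrongDual ℝ X, ‖f‖ ≤ 1 → ∃ c ∈ D,
          f ((toWeakSpace ℝ X).symm (φ t)) - ε <
            f ((toWeakSpace ℝ X).symm (φ (insert c t))) := by
  classical
  have hq : ∀ t : Finset ℕ, ∃ q, t ∈ initClosure F → t ∉ F →
      ∀ m, q ≤ m → insert m t ∈ initClosure F := fun t => by
    by_cases h : t ∈ initClosure F ∧ t ∉ F
    · obtain ⟨q, hq⟩ := hF.exists_insert_mem h.1 h.2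
      exact ⟨q, fun _ _ m hm => (hq m hm).2⟩
    · exact ⟨0, fun h1 h2 => absurd ⟨h1, h2⟩ h⟩
  choose q hq using hq
  -- Beyond `N`, every admissible `t ⊆ U` can be extended, and every point exceeds all of `U`.
  set N := U.powerset.sup q + U.sup id + 1 with hN
  have hqN : ∀ t ⊆ U, q t ≤ N := fun t ht => by
    have := Finset.le_sup (f := q) (Finset.mem_powerset.2 ht)
    omega
  have hUN : ∀ a ∈ U, a < N := fun a ha => by
    have : a ≤ U.sup id := Finset.le_sup (f := id) ha
    omega
  set S : Set ℕ := L ∩ Set.Ici N with hSdef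
  have hS : S.Infinite := Set.infinite_of_forall_exists_gt fun a => by
    obtain ⟨m, hm, h⟩ := hL.exists_gt (max a N)
    exact ⟨m, ⟨hm, by simp only [Set.mem_Ici]; omega⟩, by omega⟩
  have hC : ∀ t : Finset ℕ, ∃ C : Finset ℕ, (C : Set ℕ) ⊆ S ∧
      (t ⊆ U → t ∈ initClosure F → t ∉ F → (t : Set ℕ) ⊆ L →
        ∀ f : StrongDual ℝ X, ‖f‖ ≤ 1 → ∃ c ∈ C,
          f ((toWeakSpace ℝ X).symm (φ t)) - ε <
            f ((toWeakSpace ℝ X).symm (φ (insert c t)))) := fun t => by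
    by_cases h : t ⊆ U ∧ t ∈ initClosure F ∧ t ∉ F ∧ (t : Set ℕ) ⊆ L
    · obtain ⟨h1, h2, h3, h4⟩ := h
      have hlim : Tendsto (fun m => insert m t) (atTop ⊓ 𝓟 S)
          (𝓝[initClosure (restrict F L)] t) := by
        refine tendsto_nhdsWithin_iff.2 ⟨(tendsto_insert t).mono_left inf_le_left, ?_⟩
        rw [eventually_inf_principal]
        refine Eventually.of_forall fun m hm => ?_
        refine hF.mem_initClosure_restrict hL (hq t h2 h3 m ((hqN t h1).trans hm.2)) ?_
        rw [Finset.coe_insert]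
        exact Set.insert_subset hm.1 h4
      have hcont := (hφ.continuousOn t (hF.mem_initClosure_restrict hL h2 h4)).tendsto.comp hlim
      obtain ⟨C, hCS, hC⟩ := exists_finset_forall_dual_lt
        (y := fun m => (toWeakSpace ℝ X).symm (φ (insert m t)))
        (z := (toWeakSpace ℝ X).symm (φ t)) hS
        (fun f => ((continuous_apply_toWeakSpace_symm f).tendsto _).comp hcont) hε
      exact ⟨C, hCS, fun _ _ _ _ => hC⟩
    · exact ⟨∅, by simp, fun h1 h2 h3 h4 => absurd ⟨h1, h2, h3, h4⟩ h⟩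
  choose C hCS hC using hC
  have hDS : ∀ m ∈ U.powerset.biUnion C, m ∈ S := fun m hm => by
    obtain ⟨t, -, hmt⟩ := Finset.mem_biUnion.1 hm
    exact hCS t hmt
  refine ⟨U.powerset.biUnion C, fun m hm => (hDS m hm).1,
    fun m hm a ha => (hUN a ha).trans_le (hDS m hm).2, fun t ht h2 h3 h4 =>
    ⟨fun m hm => hq t h2 h3 m ((hqN t ht).trans (hDS m hm).2), fun f hf => ?_⟩⟩
  obtain ⟨c, hc, hfc⟩ := hC t ht h2 h3 h4 f hf
  exact ⟨c, Finset.mem_biUnion.2 ⟨t, Finset.mem_powerset.2 ht, hc⟩, hfc⟩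

/-- There is a sequence of successive finite blocks `D n ⊆ L` beyond `N` such that, along any
subsequence of blocks and for any functional `f` of the dual ball, one finds `s ∈ F ↾ L` with
one element in each of the first blocks and with `f (x s) ≥ -ε`. -/
lemma exists_blocks (hF : IsRegularThin F) (hF1 : F.Nonempty) (hL : L.Infinite)
    (hφ : IsWeaklySubordinatedBy F L x φ) (hφ0 : φ ∅ = 0) (N : ℕ) {ε : ℝ} (hε : 0 < ε) :
    ∃ D : ℕ → Finset ℕ, (∀ n, ∀ m ∈ D n, N < m) ∧
      (∀ i j, i < j → ∀ a ∈ D i, ∀ b ∈ D j, a < b) ∧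
      ∀ g : ℕ → ℕ, StrictMono g → ∀ f : StrongDual ℝ X, ‖f‖ ≤ 1 →
        ∃ s ∈ restrict F L, (∀ p < s.card, elt (s : Set ℕ) p ∈ D (g p)) ∧ -ε ≤ f (x s) := by
  choose! d hdL hdlt hd using fun (U : Finset ℕ) (ε : ℝ) (h : 0 < ε) =>
    exists_next_block hF hL hφ U h
  have hε' : ∀ n : ℕ, 0 < ε * (1 / 2) ^ (n + 1) := fun n => by positivity
  -- `U n` collects `N` and all blocks before the `n`-th, so it contains every partial choice made
  -- so far; block `n` may lose `ε / 2 ^ (n + 1)`.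
  let U : ℕ → Finset ℕ := fun n =>
    Nat.rec {N} (fun n V => V ∪ d V (ε * (1 / 2) ^ (n + 1))) n
  have hU : ∀ n, U (n + 1) = U n ∪ d (U n) (ε * (1 / 2) ^ (n + 1)) := fun n => rfl
  have hUmono : Monotone U := monotone_nat_of_le_succ fun n => by
    rw [hU]
    exact Finset.subset_union_left
  have hDU : ∀ n, d (U n) (ε * (1 / 2) ^ (n + 1)) ⊆ U (n + 1) := fun n => by
    rw [hU]
    exact Finset.subset_union_right
  refine ⟨fun n => d (U n) (ε * (1 / 2) ^ (n + 1)), fun n m hm => ?_, fun i j hij a ha b hb => ?_,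
    fun g hg f hf => ?_⟩
  · exact hdlt _ _ (hε' n) m hm N (hUmono (Nat.zero_le n) (Finset.mem_singleton_self N))
  · exact hdlt _ _ (hε' j) b hb a (hUmono hij (hDU i ha))
  -- The bound `ε * (1 - (1 / 2) ^ g t.card)` is the total loss allowed to all blocks before `g
  -- t.card`; blocks skipped by `g` only leave slack.
  have main : ∀ t : Finset ℕ, t ∈ initClosure F → (t : Set ℕ) ⊆ L → t ⊆ U (g t.card) →
      (∀ p < t.card, elt (t : Set ℕ) p ∈ d (U (g p)) (ε * (1 / 2) ^ (g p + 1))) →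
      -(ε * (1 - (1 / 2) ^ g t.card)) ≤ f ((toWeakSpace ℝ X).symm (φ t)) →
      ∃ s ∈ restrict F L,
        (∀ p < s.card, elt (s : Set ℕ) p ∈ d (U (g p)) (ε * (1 / 2) ^ (g p + 1))) ∧
        -ε ≤ f (x s) := by
    intro t
    induction t using hF.regular.compact.wellFounded_endExtends.induction with
    | _ t ih =>
      intro ht htL htU helt hft
      by_cases htF : t ∈ F
      · refine ⟨t, ⟨htF, htL⟩, helt, ?_⟩
        rw [hφ.extends_eq t ⟨htF, htL⟩, LinearEquiv.symm_apply_apply] at hft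
        have : 0 < ε * (1 / 2) ^ g t.card := by positivity
        linarith
      obtain ⟨h1, h2⟩ := hd _ _ (hε' (g t.card)) t htU ht htF htL
      obtain ⟨c, hc, hfc⟩ := h2 f hf
      have hlt : ∀ a ∈ t, a < c := fun a ha => hdlt _ _ (hε' _) c hc a (htU ha)
      have hcard : (insert c t).card = t.card + 1 :=
        Finset.card_insert_of_notMem fun h => (hlt c h).false
      have hgs : g t.card + 1 ≤ g (t.card + 1) := hg (Nat.lt_succ_self _)
      refine ih _ ⟨h1 c hc, c, hlt, rfl⟩ (h1 c hc) ?_ ?_ ?_ ?_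
      · rw [Finset.coe_insert]
        exact Set.insert_subset (hdL _ _ (hε' _) hc) htL
      · rw [hcard]
        refine Finset.Subset.trans ?_ (hUmono hgs)
        exact Finset.insert_subset (hDU _ hc) (htU.trans (hUmono (Nat.le_succ _)))
      · intro p hp
        rw [hcard] at hp
        rcases Nat.lt_succ_iff_lt_or_eq.1 hp with h | rfl
        · rw [elt_insert_of_lt_card hlt h]
          exact helt p h
        · rw [elt_insert_card hlt]
          exact hc
      · rw [hcard]
        have hpow : ((1 : ℝ) / 2) ^ g (t.card + 1) ≤ (1 / 2) ^ (g t.card + 1) :=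
          pow_le_pow_of_le_one (by norm_num) (by norm_num) hgs
        have := mul_le_mul_of_nonneg_left hpow hε.le
        have h3 : ε * (1 / 2) ^ g t.card = 2 * (ε * (1 / 2) ^ (g t.card + 1)) := by
          rw [pow_succ]; ring
        linarith
  obtain ⟨s₀, hs₀⟩ := hF1
  refine main ∅ ⟨s₀, hs₀, Finset.empty_subset _, by simp⟩ (by simp) (by simp) (by simp) ?_
  rw [hφ0, map_zero, map_zero, neg_nonpos]
  exact mul_nonneg hε.le (sub_nonneg.2 (pow_le_one₀ (by norm_num) (by norm_num)))

/-! ### Plegma tuples and passage to the spreading model. -/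

/-- The index `p * n + j` orders the pairs `(p, j)` lexicographically, so the plegma inequalities
hold whichever elements are picked within the blocks. -/
lemma isPlegma_of_blocks {n : ℕ} {D : ℕ → Finset ℕ}
    (hD : ∀ i j, i < j → ∀ a ∈ D i, ∀ b ∈ D j, a < b) {s : Fin n → Finset ℕ}
    (hne : ∀ j, (s j).Nonempty)
    (hs : ∀ j, ∀ p < (s j).card, elt (s j : Set ℕ) p ∈ D (p * n + j)) : IsPlegma s where
  nonempty := hne
  lt_of_lt i j hij p hi hj :=
    hD _ _ (Nat.add_lt_add_left hij _) _ (hs i p hi) _ (hs j p hj)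
  lt_succ i j p hi hj :=
    hD _ _ (by have := i.2; rw [Nat.succ_mul]; omega) _ (hs i p hi) _ (hs j _ hj)

/-- There are plegma tuples, arbitrarily far out, for which dropping the terms outside `A` does
almost not increase the norm. -/
lemma exists_plegma_norm_sum_le (hF : IsRegularThin F) (hF0 : ∅ ∉ F) (hF1 : F.Nonempty)
    (hL : L.Infinite) (hφ : IsWeaklySubordinatedBy F L x φ) (hφ0 : φ ∅ = 0) (N : ℕ)
    {ε : ℝ} (hε : 0 < ε) {n : ℕ} (A : Finset (Fin n)) (a : Fin n → ℝ)
    (ha : ∀ j, a j ∈ Set.Icc (-1 : ℝ) 1) :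
    ∃ s : Fin n → Finset ℕ, (∀ j, s j ∈ restrict F L) ∧ IsPlegma s ∧
      (∀ j, N < elt (s j : Set ℕ) 0) ∧
      ‖∑ j ∈ A, a j • x (s j)‖ ≤ ‖∑ j, a j • x (s j)‖ + n * ε := by
  obtain ⟨D, hDN, hD, hex⟩ := exists_blocks hF hF1 hL hφ hφ0 N hε
  have hg : ∀ j : Fin n, StrictMono fun p => p * n + (j : ℕ) := fun j p q hpq =>
    Nat.add_lt_add_right (Nat.mul_lt_mul_of_pos_right hpq j.pos) _
  choose! S hSF hSD hSf using fun (j : Fin n) => hex _ (hg j)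
  -- The sets with index in `A` are chosen for the zero functional, hence before `f`; this avoids
  -- circularity, since `f` must norm their combination.
  obtain ⟨f, hf1, hfz⟩ := exists_dual_vector'' ℝ (∑ j ∈ A, a j • x (S j 0))
  let h : Fin n → StrongDual ℝ X := fun j => if j ∈ A then 0 else a j • f
  have hh : ∀ j, ‖h j‖ ≤ 1 := fun j => by
    by_cases hj : j ∈ A
    · simp [h, hj]
    · simp only [h, hj, if_false, norm_smul, Real.norm_eq_abs]
      exact mul_le_one₀ (abs_le.2 (ha j)) (norm_nonneg _) hf1
  have hF' : ∀ j, S j (h j) ∈ F := fun j => (hSF j _ (hh j)).1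
  have hne : ∀ j, (S j (h j)).Nonempty := fun j =>
    Finset.nonempty_iff_ne_empty.2 fun h0 => hF0 (h0 ▸ hF' j)
  refine ⟨fun j => S j (h j), fun j => hSF j _ (hh j),
    isPlegma_of_blocks hD hne fun j => hSD j _ (hh j),
    fun j => hDN _ _ (hSD j _ (hh j) 0 (hne j).card_pos), ?_⟩
  have hA : ∑ j ∈ A, a j • x (S j (h j)) = ∑ j ∈ A, a j • x (S j 0) :=
    Finset.sum_congr rfl fun j hj => by simp [h, hj]
  have hAc : -(n * ε) ≤ ∑ j ∈ Aᶜ, f (a j • x (S j (h j))) := by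
    have h1 : ∑ j ∈ Aᶜ, -ε ≤ ∑ j ∈ Aᶜ, f (a j • x (S j (h j))) :=
      Finset.sum_le_sum fun j hj => by
        have h2 := hSf j _ (hh j)
        have hj' : h j = a j • f := if_neg (Finset.mem_compl.1 hj)
        rw [map_smul]
        have h3 : h j (x (S j (h j))) = a j • f (x (S j (h j))) := DFunLike.congr_fun hj' _
        rwa [h3] at h2
    have h3 : ((Aᶜ.card : ℕ) : ℝ) ≤ n := by
      exact_mod_cast (Finset.card_le_univ _).trans_eq (Fintype.card_fin n)
    rw [Finset.sum_const, nsmul_eq_mul] at h1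
    nlinarith
  have hfz' : f (∑ j ∈ A, a j • x (S j 0)) = ‖∑ j ∈ A, a j • x (S j 0)‖ := by simpa using hfz
  have hsum : f (∑ j, a j • x (S j (h j))) =
      ‖∑ j ∈ A, a j • x (S j 0)‖ + ∑ j ∈ Aᶜ, f (a j • x (S j (h j))) := by
    rw [← Finset.sum_add_sum_compl A, map_add, hA, hfz', map_sum f _ Aᶜ]
  have hle : f (∑ j, a j • x (S j (h j))) ≤ ‖∑ j, a j • x (S j (h j))‖ :=
    (le_abs_self _).trans ((f.le_of_opNorm_le hf1 _).trans_eq (one_mul _))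
  rw [hA]
  linarith

lemma norm_sum_subset_le {E : Type*} [SeminormedAddCommGroup E] [NormedSpace ℝ E]
    (hF : IsRegularThin F) (hF0 : ∅ ∉ F) (hF1 : F.Nonempty) (hL : L.Infinite)
    {e : Module.Basis ℕ ℝ E} (hgen : Generates F L x e)
    (hφ : IsWeaklySubordinatedBy F L x φ) (hφ0 : φ ∅ = 0) {n : ℕ} (A : Finset (Fin n))
    (a : Fin n → ℝ) (ha : ∀ j, a j ∈ Set.Icc (-1 : ℝ) 1) :
    ‖∑ i ∈ A, a i • e (i : ℕ)‖ ≤ ‖∑ i, a i • e (i : ℕ)‖ := by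
  classical
  rcases Nat.eq_zero_or_pos n with rfl | hn
  · simp [Finset.eq_empty_of_isEmpty A]
  obtain ⟨δ, hδ, hδ0, H⟩ := hgen
  -- With `ε = δ l`, deletion costs `n * δ l`; comparing the full and the truncated sums with the
  -- spreading model, on the same tuple, costs `δ l` each.
  have hlim : Tendsto (fun l => ‖∑ i, a i • e (i : ℕ)‖ + (n * δ l + 2 * δ l)) atTop
      (𝓝 (‖∑ i, a i • e (i : ℕ)‖ + (n * 0 + 2 * 0))) :=
    tendsto_const_nhds.add ((hδ0.const_mul _).add (hδ0.const_mul _))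
  simp only [mul_zero, add_zero] at hlim
  refine ge_of_tendsto hlim ?_
  filter_upwards [eventually_ge_atTop n] with l hl
  obtain ⟨s, hs, hpl, hN, hle⟩ := exists_plegma_norm_sum_le hF hF0 hF1 hL hφ hφ0
    (elt L (l - 1)) (hδ l) A a ha
  have h1 := H n l hn hl s hs hpl (hN _).le a ha
  have h2 := H n l hn hl s hs hpl (hN _).le (fun j => if j ∈ A then a j else 0) fun j => by
    by_cases hj : j ∈ A
    · simpa [hj] using ha j
    · simp [hj]
  simp only [ite_smul, zero_smul, Finset.sum_ite_mem, Finset.univ_inter] at h2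
  have h1' := (abs_le.1 h1).2
  have h2' := (abs_le.1 h2).1
  linarith

end Weak

/-- A seminormed sequence satisfying the 1-unconditionality inequality for coefficients in
`[-1, 1]` is 1-unconditional. -/
lemma isOneUnconditional_of_forall_mem_Icc {E : Type*} [SeminormedAddCommGroup E]
    [NormedSpace ℝ E] {e : ℕ → E}
    (h : ∀ (n : ℕ) (A : Finset (Fin n)) (a : Fin n → ℝ), (∀ j, a j ∈ Set.Icc (-1 : ℝ) 1) →
      ‖∑ i ∈ A, a i • e (i : ℕ)‖ ≤ ‖∑ i, a i • e (i : ℕ)‖) : IsOneUnconditional e := by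
  intro n A a
  -- The summand `1` keeps the scaling factor positive when all coefficients vanish.
  set M : ℝ := 1 + ∑ i, |a i| with hM
  have hM0 : 0 < M := add_pos_of_pos_of_nonneg one_pos (Finset.sum_nonneg fun _ _ => abs_nonneg _)
  have key := h n A (fun i => M⁻¹ * a i) fun j => by
    have hj : |a j| ≤ M := by
      have := Finset.single_le_sum (f := fun i => |a i|) (fun _ _ => abs_nonneg _)
        (Finset.mem_univ j)
      linarith
    rw [Set.mem_Icc, ← abs_le, abs_mul, abs_inv, abs_of_pos hM0, inv_mul_le_iff₀ hM0, mul_one]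
    exact hj
  simp only [mul_smul, ← Finset.smul_sum, norm_smul] at key
  exact le_of_mul_le_mul_left key (norm_pos_iff.2 (inv_ne_zero hM0.ne'))

end FSpreading

theorem mainTheorem5 {X E : Type*} [NormedAddCommGroup X] [NormedSpace ℝ X] [CompleteSpace X]
    [SeminormedAddCommGroup E] [NormedSpace ℝ E]
    (F : Set (Finset ℕ)) (hF : FSpreading.IsRegularThin F) (hF1 : ∃ s ∈ F, s.Nonempty)
    (L : Set ℕ) (hL : L.Infinite)
    (x : Finset ℕ → X) (e : Module.Basis ℕ ℝ E) (hgen : FSpreading.Generates F L x e)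
    (φ : Finset ℕ → WeakSpace ℝ X) (hφ : FSpreading.IsWeaklySubordinatedBy F L x φ)
    (hφ0 : φ ∅ = 0) :
    (FSpreading.IsTrivialSeq e ∧ ∀ n, ‖e n‖ = 0) ∨ FSpreading.IsOneUnconditional e := by
  exact Or.inr (FSpreading.isOneUnconditional_of_forall_mem_Icc fun n A a ha =>
    FSpreading.norm_sum_subset_le hF (hF.empty_notMem hF1) (hF1.imp fun _ h => h.1) hL hgen hφ hφ0
      A a ha)
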